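/- **Theorem 5.1.** Let $d\ge 1$, let $\mathcal A$ be a finite non-empty set, $\Omega=\mathcal A^{\mathbb Z^d}$ with its product $\sigma$-algebra, $X_i(\omega)=\omega(i)$, $\mathcal F_\Gamma=\sigma(X_i:i\in\Gamma)$ for $\Gamma\subset\mathbb Z^d$, $\|\cdot\|$ the maximum norm on $\mathbb Z^d$, $V_i(r)=\{j\in\mathbb Z^d:\|i-j\|\le r\}$, $V_i^0(r)=V_i(r)\setminus\{i\}$, and $(T_i\omega)(j)=\omega(i+j)$. *The field.* A specification is a family $\gamma=(\gamma_\Lambda)_\Lambda$, $\Lambda$ ranging over the finite subsets of $\mathbb Z^d$, of probability kernels on $\Omega$ such that $\gamma_\Lambda(S\mid\cdot)$ is $\mathcal F_{\Lambda^c}$-measurable for every measurable $S$, $\gamma_\Lambda(S\mid\omega)=1_S(\omega)$ for $S\in\mathcal F_{\Lambda^c}$, and $\int\gamma_\Delta(d\omega'\mid\omega)\,\gamma_\Lambda(S\mid\omega')=\gamma_\Delta(S\mid\omega)$ for $\Lambda\subset\Delta$. Say that $\Gamma\subset\mathbb Z^d$ *determines* $\gamma_\Lambda(\cdot\mid\omega)$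 if $\gamma_\Lambda(\cdot\mid\omega')$ and $\gamma_\Lambda(\cdot\mid\omega)$ give the same law to the configuration inside $\Lambda$ for every $\omega'$ that agrees with $\omega$ on $\Gamma$. Let $\mu$ be a translation covariant variable-neighborhood random field with specification $\gamma$, that is, a probability measure $\mu$ on $\Omega$ such that * $\int\gamma_\Lambda(S\mid\omega)\,\mu(d\omega)=\mu(S)$ for all finite $\Lambda$ and measurable $S$; * for every finite $\Lambda$ and every $\omega\in\Omega$ there is a finite set $\mathrm{sp}_\Lambda(\omega)$ that determines $\gamma_\Lambda(\cdot\mid\omega)$ and is contained in every set that determines it; * for all finite $\Lambda$, all $i\in\mathbb Z^d$ and $\omega\in\Omega$, $\gamma_\Lambda(\cdot\mid T_i\omega)$ is the image of $\gamma_{\Lambda+i}(\cdot\mid\omega)$ under $T_i$. Write $\gamma_0(a\mid\omega)=\gamma_{\{0\}}(X_0=a\mid\omega)$ and assume $q_{\min}=\inf_{a\in\mathcal A}\inf_{\omega\in\Omega}\gamma_0(a\mid\omega)>0$. Let $l_0(\omega)=\inf\{\ell>0:\mathrm{sp}_{\{0\}}(\omega)\subset V_0(\ell)\}$. For a pattern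 $\eta\in\mathcal A^{V_0^0(\ell)}$ put $l_0(\eta)=l_0(\omega)$ and $\gamma_0(a\mid\eta)=\gamma_0(a\mid\omega)$, where $\omega$ is an extension of $\eta$ to $\mathbb Z^d$; whether $l_0(\eta)\le\ell$, and if so the value $\gamma_0(a\mid\eta)$, do not depend on the extension. *The sample.* Let $\Lambda_1\subset\Lambda_2\subset\cdots$ be finite subsets of $\mathbb Z^d$ such that every finite subset of $\mathbb Z^d$ is contained in some $\Lambda_n$. Put $$\bar\Lambda_n=\{i\in\Lambda_n: V_i(k(n))\subset\Lambda_n\},\quad k(n)=(\log|\Lambda_n|)^{1/(2d)},\quad R_n=\big\lfloor(\log|\bar\Lambda_n|)^{1/(2d)}\big\rfloor$$ (with $R_n=0$ if $\bar\Lambda_n=\emptyset$). For $\eta\in\mathcal A^{V_0^0(\ell)}$ let $N_n(\eta)$ be the number of $j\in\bar\Lambda_n$ with $(\omega(j+m))_{m\in V_0^0(\ell)}=\eta$, let $N_n(\eta,a)$ be the number of those $j$ with also $\omega(j)=a$, and let $\hat p_n(a\mid\eta)=N_n(\eta,a)/N_n(\eta)$, or $0$ if $N_n(\eta)=0$. For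 $k\in\mathbb Z^d$ let $N_n^k(\eta)$ be the number of $j\in\bar\Lambda_n\cap\big(k+(4R_n+1)\mathbb Z^d\big)$ with $(\omega(j+m))_{m\in V_0^0(\ell)}=\eta$, and let $\mathcal B(n,\ell)$ be the event that $$\tfrac32\log N_n^k(\eta)\ \ge\ \log|\bar\Lambda_n|\qquad\text{for all } \|k\|\le 2R_n \text{ and all } \eta\in\mathcal A^{V_0^0(\ell)} \text{ with } l_0(\eta)\le\ell$$ (where $\log 0=-\infty$). For $\delta>0$ let $\kappa(\delta)=5^d\,(3/2)^{1/2}\,\delta$. *Claim.* There are a function $c=c(\delta,q_{\min})$, depending only on $d$ and $\mathcal A$, and, for every sequence $(\Lambda_n)$ as above, an $n_0$ that depends on neither $q_{\min}$ nor $\delta$ (nor otherwise on $\gamma$ and $\mu$), such that for every such $\gamma$ and $\mu$ and every $$\delta>2^d\,\log|\mathcal A|\,\frac{3e}{4q_{\min}}$$ one has $c(\delta,q_{\min})>0$ and, for all $n\ge n_0$, all $1\le\ell\le R_n$ and all $a\in\mathcal A$, $$\mu\Big[\Big\{\exists\,\eta\in\mathcal A^{V_0^0(\ell)},\ l_0(\eta)\le\ell:\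 |\hat p_n(a\mid\eta)-\gamma_0(a\mid\eta)|>\sqrt{\kappa(\delta)\,\gamma_0(a\mid\eta)\,\tfrac{\log N_n(\eta)}{N_n(\eta)}}\Big\}\cap\mathcal B(n,\ell)\Big]\ \le\ 4\,(4R_n+1)^d\,\exp\!\big(-c(\delta,q_{\min})\sqrt{\log|\bar\Lambda_n|}\big).$$ -/

import Mathlib

open MeasureTheory ProbabilityTheory

noncomputable section

namespace VNField

/-- Sites of the lattice `ℤ^d`. The norm `‖·‖` on this type is the maximum norm. -/
abbrev Site (d : ℕ) : Type := Fin d → ℤ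

/-- Configurations `Ω = A^{ℤ^d}`, with the product σ-algebra. -/
abbrev Config (d : ℕ) (A : Type*) : Type _ := Site d → A

/-- The cube `V_i(r) = {j : ‖i - j‖ ≤ r}`. -/
def cube {d : ℕ} (i : Site d) (r : ℝ) : Set (Site d) := {j | ‖i - j‖ ≤ r}

/-- The punctured cube `V_i^0(r) = V_i(r) \ {i}`. -/
def puncturedCube {d : ℕ} (i : Site d) (r : ℝ) : Set (Site d) := cube i r \ {i}

/-- The shift `(T_i ω)(j) = ω(i + j)`. -/
def shift {d : ℕ} {A : Type*} (i : Site d) (ω : Config d A) : Config d A := fun j => ω (i + j)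

/-- A specification: a family of probability kernels `γ_Λ`, `Λ` finite, on `(Ω, F)`; here
`cylinderEvents Γ` is the σ-algebra `F_Γ` generated by the coordinates in `Γ`. -/
structure Specification (d : ℕ) (A : Type*) [MeasurableSpace A] where
  /-- the kernel `γ_Λ(· | ω)` -/
  ker : Finset (Site d) → Kernel (Config d A) (Config d A)
  isMarkov : ∀ Λ, IsMarkovKernel (ker Λ)
  measurable_outside : ∀ (Λ : Finset (Site d)) (S : Set (Config d A)), MeasurableSet S →
    Measurable[cylinderEvents ((Λ : Set (Site d))ᶜ)] (fun ω => ker Λ ω S)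
  proper : ∀ (Λ : Finset (Site d)) (S : Set (Config d A)),
    MeasurableSet[cylinderEvents ((Λ : Set (Site d))ᶜ)] S →
    ∀ ω, ker Λ ω S = S.indicator 1 ω
  compatible : ∀ Λ Δ : Finset (Site d), Λ ⊆ Δ → ∀ S : Set (Config d A), MeasurableSet S →
    ∀ ω, ∫⁻ ω', ker Λ ω' S ∂(ker Δ ω) = ker Δ ω S

section

variable {d : ℕ} {A : Type*} [MeasurableSpace A]

/-- `μ` is consistent with `γ`. -/
def IsConsistent (γ : Specification d A) (μ : Measure (Config d A)) : Prop :=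
  ∀ (Λ : Finset (Site d)) (S : Set (Config d A)), MeasurableSet S →
    ∫⁻ ω, γ.ker Λ ω S ∂μ = μ S

/-- The law of the configuration inside `Λ` under `γ_Λ(· | ω)`, a measure on `A^Λ`. -/
def localLaw (γ : Specification d A) (Λ : Finset (Site d)) (ω : Config d A) :
    Measure (Λ → A) :=
  (γ.ker Λ ω).map (fun ω' (i : Λ) => ω' i)

/-- `γ_Λ(· | ω_{Λᶜ}) = γ_Λ(· | ω_Γ)`: the conditional law of the configuration in `Λ` is the same
for all boundary conditions that agree with `ω` on `Γ`. -/
def Determines (γ : Specification d A) (Λ : Finset (Site d)) (ω : Config d A)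
    (Γ : Set (Site d)) : Prop :=
  ∀ ω' : Config d A, (∀ j ∈ Γ, ω' j = ω j) → localLaw γ Λ ω' = localLaw γ Λ ω

/-- `μ` is a variable-neighborhood random field with specification `γ`: it is consistent with `γ`,
and for every finite `Λ` and every `ω` there is a finite set that determines `γ_Λ(· | ω)` and is
contained in every set that does. -/
structure IsVariableNeighborhoodField (γ : Specification d A) (μ : Measure (Config d A)) :
    Prop where
  consistent : IsConsistent γ μ
  finite_context : ∀ (Λ : Finset (Site d)) (ω : Config d A),
    ∃ Γ : Set (Site d), Γ.Finite ∧ IsLeast {Γ' : Set (Site d) | Determines γ Λ ω Γ'} Γ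

/-- The support `sp_Λ(ω)` of the context: the least determining set, whenever there is one. -/
def contextSupport (γ : Specification d A) (Λ : Finset (Site d)) (ω : Config d A) :
    Set (Site d) :=
  ⋂₀ {Γ : Set (Site d) | Determines γ Λ ω Γ}

/-- The context length `l_i(ω) = inf {ℓ > 0 : sp_i(ω) ⊆ V_i(ℓ)}`. -/
def contextLength (γ : Specification d A) (i : Site d) (ω : Config d A) : ℕ :=
  sInf {ℓ : ℕ | 0 < ℓ ∧ contextSupport γ {i} ω ⊆ cube i ℓ}

/-- Translation covariance: `γ_{Λ+i}(· | ω)`, seen from `i`, is `γ_Λ(· | T_i ω)`. -/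
def IsTranslationCovariant (γ : Specification d A) : Prop :=
  ∀ (Λ : Finset (Site d)) (i : Site d) (ω : Config d A),
    (γ.ker (Λ.map (addLeftEmbedding i)) ω).map (shift i) = γ.ker Λ (shift i ω)

/-- The one-point specification at the origin, `γ_0(a | ω) = γ_{{0}}(X_0 = a | ω)`. -/
def onePoint (γ : Specification d A) (a : A) (ω : Config d A) : ℝ :=
  (γ.ker {0} ω).real {ω' | ω' 0 = a}

/-- `q_min = inf_a inf_ω γ_0(a | ω)`. -/
def qMin (γ : Specification d A) : ℝ := ⨅ a : A, ⨅ ω : Config d A, onePoint γ a ω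

end

/-! Patterns. -/

/-- Patterns of radius `ℓ`: elements of `A^{V_0^0(ℓ)}`. -/
abbrev Pattern (d : ℕ) (A : Type*) (ℓ : ℕ) : Type _ :=
  puncturedCube (0 : Site d) (ℓ : ℝ) → A

section

variable {d : ℕ} {A : Type*}

/-- The pattern `X_j^ℓ(ω)` of radius `ℓ` around the site `j`. -/
def patternAt (ℓ : ℕ) (j : Site d) (ω : Config d A) : Pattern d A ℓ := fun m => ω (j + m)

open Classical in
/-- Some configuration that extends the pattern `η`. -/
def extend [Nonempty A] {ℓ : ℕ} (η : Pattern d A ℓ) : Config d A :=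
  fun j => if h : j ∈ puncturedCube (0 : Site d) (ℓ : ℝ) then η ⟨j, h⟩ else Classical.arbitrary A

/-- The context length `l_0(η)` of a pattern, read off from an extension of `η`. The assertion
`l_0(η) ≤ ℓ` does not depend on the extension, see `patternLength_le_iff`. -/
def patternLength [Nonempty A] [MeasurableSpace A] (γ : Specification d A) {ℓ : ℕ}
    (η : Pattern d A ℓ) : ℕ :=
  contextLength γ 0 (extend η)

/-- `γ_0(a | η)`, read off from an extension of `η`. If `l_0(η) ≤ ℓ` then this does not depend on
the extension, see `onePointPattern_eq`. -/
def onePointPattern [Nonempty A] [MeasurableSpace A] (γ : Specification d A) {ℓ : ℕ} (a : A)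
    (η : Pattern d A ℓ) : ℝ :=
  onePoint γ a (extend η)

end

/-! Sampling windows and empirical frequencies. -/

section

variable {d : ℕ}

open Classical in
/-- The security region: the sites `i ∈ Λ` with `V_i(k) ⊆ Λ`, where
`k = (log |Λ|)^{1/(2d)}`. -/
def securityRegion (Λ : Finset (Site d)) : Finset (Site d) :=
  Λ.filter (fun i => cube i ((Real.log (Λ.card : ℝ)) ^ (1 / (2 * (d : ℝ)))) ⊆ (Λ : Set (Site d)))

/-- The security diameter `R = [(log |Λ̄|)^{1/(2d)}]`, `Λ̄` the security region. -/
def securityDiameter (Λ : Finset (Site d)) : ℕ :=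
  ⌊(Real.log ((securityRegion Λ).card : ℝ)) ^ (1 / (2 * (d : ℝ)))⌋₊

open Classical in
/-- The intersection of the security region with the sublattice `k + (4R+1) ℤ^d`. -/
def sublatticeRegion (Λ : Finset (Site d)) (k : Site d) : Finset (Site d) :=
  (securityRegion Λ).filter
    (fun j => ∃ l : Site d, j = k + (4 * (securityDiameter Λ : ℤ) + 1) • l)

variable {A : Type*}

open Classical in
/-- The number of sites in `D` around which the pattern `η` occurs in `ω`. -/
def occurrences (D : Finset (Site d)) {ℓ : ℕ} (η : Pattern d A ℓ) (ω : Config d A) : ℕ :=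
  (D.filter (fun j => patternAt ℓ j ω = η)).card

open Classical in
/-- The number of sites in `D` around which `η` occurs in `ω`, with the symbol `a` at the
centre. -/
def occurrencesWith (D : Finset (Site d)) {ℓ : ℕ} (η : Pattern d A ℓ) (a : A)
    (ω : Config d A) : ℕ :=
  (D.filter (fun j => patternAt ℓ j ω = η ∧ ω j = a)).card

/-- The estimator `p̂(a | η) = N(η, a) / N(η)`, and `0` if `N(η) = 0`. -/
def empirical (Λ : Finset (Site d)) {ℓ : ℕ} (a : A) (η : Pattern d A ℓ) (ω : Config d A) : ℝ :=
  if 0 < occurrences (securityRegion Λ) η ω then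
    (occurrencesWith (securityRegion Λ) η a ω : ℝ) / (occurrences (securityRegion Λ) η ω : ℝ)
  else 0

variable [Nonempty A] [MeasurableSpace A]

/-- The event that `(3/2) log N^k(η) ≥ log |Λ̄|` (with `log 0 = -∞`) for every pattern `η` of radius
`ℓ ≥ l_0(η)`, where `N^k` counts the occurrences in the `k`-th sublattice. -/
def sublatticeEvent (γ : Specification d A) (Λ : Finset (Site d)) (ℓ : ℕ) (k : Site d) :
    Set (Config d A) :=
  {ω | ∀ η : Pattern d A ℓ, patternLength γ η ≤ ℓ →
    0 < occurrences (sublatticeRegion Λ k) η ω ∧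
    Real.log ((securityRegion Λ).card : ℝ) ≤
      3 / 2 * Real.log (occurrences (sublatticeRegion Λ k) η ω : ℝ)}

/-- The event `B(n, ℓ)`: the intersection of the preceding events over `‖k‖ ≤ 2R`. -/
def goodEvent (γ : Specification d A) (Λ : Finset (Site d)) (ℓ : ℕ) : Set (Config d A) :=
  {ω | ∀ k : Site d, ‖k‖ ≤ 2 * (securityDiameter Λ : ℝ) → ω ∈ sublatticeEvent γ Λ ℓ k}

/-- The event that for some pattern `η` of radius `ℓ ≥ l_0(η)`
`|p̂(a | η) - γ_0(a | η)| > √(κ γ_0(a | η) log N(η) / N(η))`. -/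
def deviationEvent (γ : Specification d A) (Λ : Finset (Site d)) (ℓ : ℕ) (κ : ℝ) (a : A) :
    Set (Config d A) :=
  {ω | ∃ η : Pattern d A ℓ, patternLength γ η ≤ ℓ ∧
    Real.sqrt (κ * onePointPattern γ a η *
        (Real.log (occurrences (securityRegion Λ) η ω : ℝ) /
          (occurrences (securityRegion Λ) η ω : ℝ))) <
      |empirical Λ a η ω - onePointPattern γ a η|}

end

/-- `κ(δ) = 5^d (3/2)^{1/2} δ`. -/
def kappa (d : ℕ) (δ : ℝ) : ℝ := 5 ^ d * Real.sqrt (3 / 2) * δ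

/-! Independence of the chosen extension. -/

section

variable {d : ℕ} {A : Type*}

theorem patternAt_extend [Nonempty A] {ℓ : ℕ} (η : Pattern d A ℓ) : patternAt ℓ 0 (extend η) = η := by
  funext m
  have hm : 0 + (m : Site d) ∈ puncturedCube (0 : Site d) (ℓ : ℝ) := by
    rw [zero_add]; exact m.2
  simp only [patternAt, extend]
  rw [dif_pos hm]
  congr 1
  exact Subtype.ext (zero_add _)

variable [MeasurableSpace A]

theorem localLaw_congr (γ : Specification d A) (Λ : Finset (Site d)) {ω ω' : Config d A}
    (h : ∀ j ∉ Λ, ω' j = ω j) : localLaw γ Λ ω' = localLaw γ Λ ω := by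
  have key : γ.ker Λ ω' = γ.ker Λ ω := by
    ext S hS
    have hm := γ.measurable_outside Λ S hS
    have hle : (cylinderEvents ((Λ : Set (Site d))ᶜ) : MeasurableSpace (Config d A)) ≤
        MeasurableSpace.comap (Set.domRestrict ((Λ : Set (Site d))ᶜ)) ⊤ := by
      refine iSup₂_le fun i hi => ?_
      rintro _ ⟨t, -, rfl⟩
      exact ⟨{f | f ⟨i, hi⟩ ∈ t}, trivial, rfl⟩
    have hs : MeasurableSet[cylinderEvents ((Λ : Set (Site d))ᶜ)]
        {ω'' : Config d A | γ.ker Λ ω'' S = γ.ker Λ ω S} := hm (measurableSet_singleton _)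
    obtain ⟨t, -, ht⟩ := hle _ hs
    have hr : Set.domRestrict ((Λ : Set (Site d))ᶜ) ω' = Set.domRestrict ((Λ : Set (Site d))ᶜ) ω := by
      funext j
      exact h j (fun hj => j.2 (Finset.mem_coe.2 hj))
    have h1 : ω ∈ Set.domRestrict ((Λ : Set (Site d))ᶜ) ⁻¹' t := by rw [ht]; rfl
    have h2 : ω' ∈ Set.domRestrict ((Λ : Set (Site d))ᶜ) ⁻¹' t := by
      rw [Set.mem_preimage, hr]; exact h1
    rw [ht] at h2
    exact h2
  simp only [localLaw, key]

theorem cube_mono {i : Site d} {r s : ℝ} (h : r ≤ s) : cube i r ⊆ cube i s :=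
  fun _ hj => le_trans hj h

/-- A configuration that agrees with `ω` on the punctured cube of radius `ℓ ≥ l_0(ω)` has the same
one-point law, and context length at most `ℓ`. -/
theorem contextLength_le_of_agree {γ : Specification d A} {μ : Measure (Config d A)}
    (h : IsVariableNeighborhoodField γ μ) {ℓ : ℕ} {ω ω' : Config d A}
    (hag : patternAt ℓ 0 ω' = patternAt ℓ 0 ω) (hω : contextLength γ 0 ω ≤ ℓ) :
    localLaw γ {0} ω' = localLaw γ {0} ω ∧ contextLength γ 0 ω' ≤ ℓ := by
  obtain ⟨Γ, hfin, hΓ⟩ := h.finite_context {0} ω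
  have hsp : contextSupport γ {0} ω = Γ := hΓ.csInf_eq
  have h0 : (0 : Site d) ∉ Γ := by
    have hd : Determines γ {0} ω ({0}ᶜ : Set (Site d)) := fun ω'' h'' =>
      localLaw_congr γ {0} fun j hj => h'' j (by simpa using hj)
    exact fun hmem => hΓ.2 hd hmem rfl
  have hne : {m : ℕ | 0 < m ∧ contextSupport γ {0} ω ⊆ cube 0 m}.Nonempty := by
    obtain ⟨C, hC⟩ := (hfin.image (fun j : Site d => ‖(0 : Site d) - j‖)).bddAbove
    obtain ⟨m, hm⟩ := exists_nat_ge C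
    refine ⟨m + 1, Nat.succ_pos _, ?_⟩
    rw [hsp]
    intro j hj
    have := hC ⟨j, hj, rfl⟩
    simp only [cube, Set.mem_ofPred_eq]
    push_cast
    simp only at this
    linarith
  obtain ⟨hpos, hsub⟩ := Nat.sInf_mem hne
  have hsubℓ : Γ ⊆ cube 0 (ℓ : ℝ) := by
    rw [← hsp]
    exact hsub.trans (cube_mono (by exact_mod_cast hω))
  have hagΓ : ∀ j ∈ Γ, ω' j = ω j := by
    intro j hj
    have hj0 : j ∈ puncturedCube (0 : Site d) (ℓ : ℝ) :=
      ⟨hsubℓ hj, fun hj' => h0 (by rw [Set.mem_singleton_iff] at hj'; exact hj' ▸ hj)⟩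
    have := congrFun hag ⟨j, hj0⟩
    simpa [patternAt] using this
  have hlaw : localLaw γ {0} ω' = localLaw γ {0} ω := hΓ.1 ω' hagΓ
  refine ⟨hlaw, Nat.sInf_le ⟨lt_of_lt_of_le hpos hω, ?_⟩⟩
  have hdet : Determines γ {0} ω' Γ := fun ω'' h'' => by
    rw [hlaw]
    exact hΓ.1 ω'' fun j hj => (h'' j hj).trans (hagΓ j hj)
  exact (Set.sInter_subset_of_mem hdet).trans hsubℓ

/-- The assertion `l_0(η) ≤ ℓ` may be tested on any extension of `η`. -/
theorem patternLength_le_iff [Nonempty A] {γ : Specification d A} {μ : Measure (Config d A)}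
    (h : IsVariableNeighborhoodField γ μ) {ℓ : ℕ} (ω : Config d A) :
    patternLength γ (patternAt ℓ 0 ω) ≤ ℓ ↔ contextLength γ 0 ω ≤ ℓ :=
  ⟨fun hη => (contextLength_le_of_agree h (patternAt_extend _).symm hη).2,
    fun hω => (contextLength_le_of_agree h (patternAt_extend _) hω).2⟩

/-- If `l_0(η) ≤ ℓ`, then `γ_0(a | η)` may be computed from any extension of `η`. -/
theorem onePointPattern_eq [Nonempty A] [MeasurableSingletonClass A] {γ : Specification d A}
    {μ : Measure (Config d A)} (h : IsVariableNeighborhoodField γ μ) {ℓ : ℕ} (a : A)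
    (ω : Config d A) (hω : contextLength γ 0 ω ≤ ℓ) :
    onePointPattern γ a (patternAt ℓ 0 ω) = onePoint γ a ω := by
  have hlaw := (contextLength_le_of_agree h (patternAt_extend (patternAt ℓ 0 ω)) hω).1
  have hmeas : Measurable (fun (ω' : Config d A) (i : ({0} : Finset (Site d))) => ω' i) := by
    fun_prop
  have hp : Measurable (fun x : ({0} : Finset (Site d)) → A => x ⟨0, by simp⟩) :=
    measurable_pi_apply _
  have hS : MeasurableSet {x : ({0} : Finset (Site d)) → A | x ⟨0, by simp⟩ = a} :=
    hp (measurableSet_singleton a)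
  have hE : ∀ ω₁ : Config d A, γ.ker {0} ω₁ {ω' | ω' 0 = a} =
      localLaw γ {0} ω₁ {x : ({0} : Finset (Site d)) → A | x ⟨0, by simp⟩ = a} := by
    intro ω₁
    rw [localLaw, Measure.map_apply hmeas hS]
    rfl
  simp only [onePointPattern, onePoint, Measure.real, hE, hlaw]

end

end VNField

end

open MeasureTheory ProbabilityTheory

noncomputable section

namespace VNField

/-! ### Centred pattern counts. -/

section

variable {d : ℕ} {A : Type*}

/-! Put L = log|Λ̄|, and let S = N(η,a) - pN(η) with p = γ_0(a|η) be the centred count. Three ideas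
carry the proof.

Sparse sites decouple. Let D consist of sites at mutual distance greater than ℓ. Resampling the
symbol at one site of D changes none of the patterns of radius ℓ around sites of D, nor the symbols
at the other sites. Where η occurs, the resampled symbol has law γ_0(·|η). Hence E exp(tS - vN) ≤ 1
on D as soon as v dominates the logarithmic moment generating function of one centred Bernoulli(p)
variable (`lintegral_prod_le_one`, `lintegral_exp_centred_le_one`). No mixing of μ is needed.

The random N is handled by peeling. On each block 4^s ≤ N < 4^(s+1) one deterministic t is nearly
optimal. A union over about L blocks and two signs gives a Gaussian tail; N ≥ exp(2L/3), which the
good event provides, keeps the cap on t harmless (`le_blockParam_exponent`,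
`measure_sparse_deviation_le`).

The security region splits into (4R+1)^d ≤ 5^d √L such sparse sublattices. By Cauchy-Schwarz, a
deviation of order √(κ p N log N) on the whole region forces one of order √(T p N_k), with T = δ
√(2/3) √L, on some sublattice (`exists_sublattice_deviation`).

A union bound over sublattices and patterns finishes (`measureReal_deviation_le`). There are at most
|A|^((2ℓ+1)^d), that is exp((1 + o(1)) B √L) patterns with B = 2^d log|A|, and the lower bound on δ
makes the exponent 2T/5 exceed 13/10 · B √L. -/

theorem patternAt_shift {ℓ : ℕ} (j : Site d) (ω : Config d A) :
    patternAt ℓ 0 (shift j ω) = patternAt ℓ j ω := by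
  funext m; simp [patternAt, shift]

theorem mem_puncturedCube_of_norm_sub_le {ℓ : ℕ} {i j m : Site d}
    (hm : m ∈ puncturedCube (0 : Site d) (ℓ : ℝ)) (h : j = i + m) : i ≠ j ∧ ‖i - j‖ ≤ ℓ := by
  subst h
  refine ⟨fun h => hm.2 (by simpa using h), ?_⟩
  simpa [cube] using hm.1

/-- The centred number of occurrences of `a` inside the pattern `η` on `D`. -/
def centred (D : Finset (Site d)) {ℓ : ℕ} (η : Pattern d A ℓ) (a : A) (p : ℝ)
    (ω : Config d A) : ℝ :=
  (occurrencesWith D η a ω : ℝ) - p * occurrences D η ω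

open Classical in
theorem centred_eq_sum (D : Finset (Site d)) {ℓ : ℕ} (η : Pattern d A ℓ) (a : A) (p : ℝ)
    (ω : Config d A) :
    centred D η a p ω =
      ∑ j ∈ D, if patternAt ℓ j ω = η then (if ω j = a then 1 else 0) - p else 0 := by
  rw [centred, occurrencesWith, occurrences, ← Finset.sum_filter, Finset.sum_sub_distrib,
    ← Finset.sum_filter, Finset.filter_filter]
  simp [mul_comm]

end

/-! ### One-site resampling and the exponential bound on sparse sets. -/

section

variable {d : ℕ} {A : Type*} [MeasurableSpace A]

/-- Under `γ_{j}(· | ω)` the configuration outside `j` is almost surely that of `ω`. -/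
theorem ae_eq_outside [MeasurableSingletonClass A] (γ : Specification d A) (j : Site d)
    (ω : Config d A) : ∀ᵐ ω' ∂(γ.ker {j} ω), ∀ i, i ≠ j → ω' i = ω i := by
  have := γ.isMarkov {j}
  rw [ae_all_iff]
  intro i
  by_cases hij : i = j
  · simp [hij]
  have hS : MeasurableSet[cylinderEvents ((({j} : Finset (Site d)) : Set (Site d))ᶜ)]
      {ω' : Config d A | ω' i = ω i} :=
    (measurable_cylinderEvent_apply (X := fun _ : Site d => A) (i := i) (by simpa using hij))
      (measurableSet_singleton _)
  have h1 := γ.proper {j} _ hS ω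
  rw [Set.indicator_of_mem (by simp)] at h1
  have h2 : ∀ᵐ ω' ∂(γ.ker {j} ω), ω' i = ω i := by
    refine (mem_ae_iff_prob_eq_one ?_).2 h1
    exact (measurable_pi_apply i) (measurableSet_singleton _)
  filter_upwards [h2] with ω' h _ using h

theorem bind_ker_eq {γ : Specification d A} {μ : Measure (Config d A)} (h : IsConsistent γ μ)
    (Λ : Finset (Site d)) : μ.bind (γ.ker Λ) = μ := by
  ext S hS
  rw [Measure.bind_apply hS (γ.ker Λ).aemeasurable, h Λ S hS]

theorem lintegral_ker {γ : Specification d A} {μ : Measure (Config d A)} (h : IsConsistent γ μ)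
    (Λ : Finset (Site d)) {f : Config d A → ENNReal} (hf : Measurable f) :
    ∫⁻ ω, ∫⁻ ω', f ω' ∂(γ.ker Λ ω) ∂μ = ∫⁻ ω, f ω ∂μ := by
  conv_rhs => rw [← bind_ker_eq h Λ]
  rw [Measure.lintegral_bind (γ.ker Λ).aemeasurable hf.aemeasurable]

theorem measurable_patternAt (ℓ : ℕ) (j : Site d) :
    Measurable (fun ω : Config d A => patternAt ℓ j ω) :=
  measurable_pi_lambda _ fun _ => measurable_pi_apply _

theorem measurable_shift (j : Site d) : Measurable (shift (A := A) j) :=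
  measurable_pi_lambda _ fun _ => measurable_pi_apply _

theorem ker_singleton_apply [MeasurableSingletonClass A] {γ : Specification d A}
    (hT : IsTranslationCovariant γ) (j : Site d) (ω : Config d A) (a : A) :
    γ.ker {j} ω {ω' | ω' j = a} = γ.ker {0} (shift j ω) {ω' | ω' 0 = a} := by
  have hS : MeasurableSet {ω' : Config d A | ω' 0 = a} :=
    measurable_pi_apply (X := fun _ : Site d => A) 0 (measurableSet_singleton a)
  rw [← hT {0} j ω, Measure.map_apply (measurable_shift j) hS]
  simp [shift]

/-- At a site where the pattern `η` of radius `ℓ ≥ l_0(η)` occurs, the one-site kernel is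
`γ_0(· | η)`. -/
theorem ker_singleton_eq_ofReal [Nonempty A] [MeasurableSingletonClass A] {γ : Specification d A}
    {μ : Measure (Config d A)} (h : IsVariableNeighborhoodField γ μ)
    (hT : IsTranslationCovariant γ) {ℓ : ℕ} {η : Pattern d A ℓ} (hη : patternLength γ η ≤ ℓ)
    {j : Site d} {ω : Config d A} (hω : patternAt ℓ j ω = η) (a : A) :
    γ.ker {j} ω {ω' | ω' j = a} = ENNReal.ofReal (onePointPattern γ a η) := by
  have := γ.isMarkov {0}
  have h0 : patternAt ℓ 0 (shift j ω) = η := by rw [patternAt_shift, hω]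
  have hl : contextLength γ 0 (shift j ω) ≤ ℓ := by
    rw [← patternLength_le_iff h, h0]; exact hη
  rw [ker_singleton_apply hT, ← h0, onePointPattern_eq h a _ hl, onePoint, ofReal_measureReal]

/-- Sites at mutual distance greater than `ℓ` are independent given the occurrences of a pattern
`η` of radius `ℓ ≥ l_0(η)`: product bound for generating functions. -/
theorem lintegral_prod_le_one [Nonempty A] [Fintype A] [DiscreteMeasurableSpace A]
    {γ : Specification d A}
    {μ : Measure (Config d A)} [IsProbabilityMeasure μ] (h : IsVariableNeighborhoodField γ μ)
    (hT : IsTranslationCovariant γ) {ℓ : ℕ} {η : Pattern d A ℓ} (hη : patternLength γ η ≤ ℓ)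
    (g : A → ENNReal) (hg : ∑ b, g b * ENNReal.ofReal (onePointPattern γ b η) ≤ 1)
    [DecidableEq (Pattern d A ℓ)]
    (D : Finset (Site d)) (hD : ∀ i ∈ D, ∀ j ∈ D, i ≠ j → (ℓ : ℝ) < ‖i - j‖) :
    ∫⁻ ω, ∏ j ∈ D, (if patternAt ℓ j ω = η then g (ω j) else 1) ∂μ ≤ 1 := by
  classical
  have hmeas : ∀ j : Site d, Measurable
      (fun ω : Config d A => if patternAt ℓ j ω = η then g (ω j) else 1) := fun j =>
    Measurable.ite ((measurable_patternAt ℓ j) (measurableSet_singleton η))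
      ((measurable_of_finite g).comp (measurable_pi_apply j)) measurable_const
  induction D using Finset.induction_on with
  | empty => simp
  | insert j D hj ih =>
    refine le_trans ?_ (ih fun i hi k hk => hD i (Finset.mem_insert_of_mem hi) k
      (Finset.mem_insert_of_mem hk))
    -- Resample the symbol at `j`; consistency leaves the integral unchanged. The order in which the
    -- sites are treated is immaterial.
    rw [← lintegral_ker h.consistent {j}
      (Finset.measurable_prod (insert j D) fun i _ => hmeas i)]
    refine lintegral_mono fun ω => ?_
    have := γ.isMarkov {j}
    have hF : ∀ᵐ ω' ∂(γ.ker {j} ω),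
        ∏ i ∈ insert j D, (if patternAt ℓ i ω' = η then g (ω' i) else 1) =
        (∏ i ∈ D, (if patternAt ℓ i ω = η then g (ω i) else 1)) *
          (if patternAt ℓ j ω = η then g (ω' j) else 1) := by
      filter_upwards [ae_eq_outside γ j ω] with ω' hω'
      rw [Finset.prod_insert hj, mul_comm]
      -- The cube is punctured, so the pattern around `j` does not see the resampled symbol.
      have hpj : patternAt ℓ j ω' = patternAt ℓ j ω := funext fun m =>
        hω' _ (mem_puncturedCube_of_norm_sub_le m.2 rfl).1.symm
      rw [hpj]
      congr 1
      refine Finset.prod_congr rfl fun i hi => ?_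
      have hij : i ≠ j := fun hij => hj (hij ▸ hi)
      have hpi : patternAt ℓ i ω' = patternAt ℓ i ω := funext fun m => hω' _ fun hm => by
        have h1 := (mem_puncturedCube_of_norm_sub_le m.2 hm.symm).2
        exact absurd (hD i (Finset.mem_insert_of_mem hi) j (Finset.mem_insert_self _ _) hij)
          (not_lt.2 h1)
      rw [hpi, hω' i hij]
    rw [lintegral_congr_ae hF]
    by_cases hp : patternAt ℓ j ω = η
    · simp only [hp, if_true]
      have hgm : Measurable fun ω' : Config d A => g (ω' j) :=
        (measurable_of_finite g).comp (measurable_pi_apply j)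
      rw [lintegral_const_mul _ hgm]
      refine (mul_le_mul_right ?_ _).trans (mul_one _).le
      rw [← lintegral_map (f := g) (measurable_of_finite g) (measurable_pi_apply j),
        lintegral_fintype]
      refine le_trans (le_of_eq (Finset.sum_congr rfl fun b _ => ?_)) hg
      rw [Measure.map_apply (measurable_pi_apply j) (measurableSet_singleton b),
        ← ker_singleton_eq_ofReal h hT hη hp b]
      rfl
    · simp [hp]

theorem onePoint_nonneg (γ : Specification d A) (a : A) (ω : Config d A) : 0 ≤ onePoint γ a ω :=
  measureReal_nonneg

theorem qMin_le_onePoint [Finite A] (γ : Specification d A) (a : A) (ω : Config d A) :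
    qMin γ ≤ onePoint γ a ω :=
  (ciInf_le (Set.finite_range _).bddBelow a).trans
    (ciInf_le ⟨0, by rintro _ ⟨ω, rfl⟩; exact onePoint_nonneg γ a ω⟩ ω)

theorem sum_onePoint [Fintype A] [DiscreteMeasurableSpace A] (γ : Specification d A)
    (ω : Config d A) : ∑ a, onePoint γ a ω = 1 := by
  have := γ.isMarkov {0}
  have hm : Measurable fun ω' : Config d A => ω' 0 := measurable_pi_apply 0
  have : IsProbabilityMeasure ((γ.ker {0} ω).map fun ω' => ω' 0) :=
    Measure.isProbabilityMeasure_map hm.aemeasurable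
  have h1 : ∀ a, onePoint γ a ω = ((γ.ker {0} ω).map fun ω' => ω' 0).real {a} := fun a => by
    rw [onePoint, map_measureReal_apply hm (measurableSet_singleton a)]; rfl
  simp only [h1]
  rw [sum_measureReal_singleton]
  simp

/-- With at least two symbols this gives `qMin γ ≤ 1 / 2`, which sharpens the lower bound on δ. -/
theorem card_mul_qMin_le_one [Fintype A] [DiscreteMeasurableSpace A] [Nonempty A]
    (γ : Specification d A) : (Fintype.card A : ℝ) * qMin γ ≤ 1 := by
  let ω : Config d A := fun _ => Classical.arbitrary A
  calc (Fintype.card A : ℝ) * qMin γ = ∑ _a : A, qMin γ := by simp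
    _ ≤ ∑ a, onePoint γ a ω := Finset.sum_le_sum fun a _ => qMin_le_onePoint γ a ω
    _ = 1 := sum_onePoint γ ω

/-- Exponential supermartingale bound for the centred counts on a sparse set of sites. -/
theorem lintegral_exp_centred_le_one [Nonempty A] [Fintype A] [DiscreteMeasurableSpace A]
    {γ : Specification d A}
    {μ : Measure (Config d A)} [IsProbabilityMeasure μ] (h : IsVariableNeighborhoodField γ μ)
    (hT : IsTranslationCovariant γ) {ℓ : ℕ} {η : Pattern d A ℓ} (hη : patternLength γ η ≤ ℓ)
    (D : Finset (Site d)) (hD : ∀ i ∈ D, ∀ j ∈ D, i ≠ j → (ℓ : ℝ) < ‖i - j‖) (a : A) (t v : ℝ)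
    (hv : 1 - onePointPattern γ a η + onePointPattern γ a η * Real.exp t ≤
      Real.exp (onePointPattern γ a η * t + v)) :
    ∫⁻ ω, ENNReal.ofReal (Real.exp (t * centred D η a (onePointPattern γ a η) ω -
      v * occurrences D η ω)) ∂μ ≤ 1 := by
  classical
  set p := onePointPattern γ a η with hp
  -- The factor contributed by one occurrence of η; `hv` says exactly that its mean under γ_0(·|η)
  -- is at most 1.
  let g : A → ENNReal := fun b =>
    ENNReal.ofReal (Real.exp (t * ((if b = a then 1 else 0) - p) - v))
  have hg : ∑ b, g b * ENNReal.ofReal (onePointPattern γ b η) ≤ 1 := by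
    have h1 : ∀ b, g b * ENNReal.ofReal (onePointPattern γ b η) =
        ENNReal.ofReal (Real.exp (t * ((if b = a then 1 else 0) - p) - v) *
          onePointPattern γ b η) := fun b => by
      rw [ENNReal.ofReal_mul (Real.exp_pos _).le]
    simp only [h1]
    rw [← ENNReal.ofReal_sum_of_nonneg fun b _ => mul_nonneg (Real.exp_pos _).le
      (show 0 ≤ onePointPattern γ b η from onePoint_nonneg γ b _), ENNReal.ofReal_le_one]
    have h2 : ∀ b, Real.exp (t * ((if b = a then 1 else 0) - p) - v) * onePointPattern γ b η =
        Real.exp (-(p * t + v)) * (onePointPattern γ b η) +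
        (if b = a then Real.exp (-(p * t + v)) * ((Real.exp t - 1) * p) else 0) := by
      intro b
      split_ifs with hb
      · subst hb
        rw [← hp, show t * (1 - p) - v = -(p * t + v) + t by ring, Real.exp_add]
        ring
      · rw [add_zero]; congr 2; ring
    simp only [h2]
    rw [Finset.sum_add_distrib, ← Finset.mul_sum, show ∑ b, onePointPattern γ b η = 1 from
      sum_onePoint γ _, Finset.sum_ite_eq' Finset.univ a]
    simp only [Finset.mem_univ, if_true]
    calc _ = Real.exp (-(p * t + v)) * (1 - p + p * Real.exp t) := by ring
      _ ≤ Real.exp (-(p * t + v)) * Real.exp (p * t + v) := by gcongr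
      _ = 1 := by rw [← Real.exp_add]; simp
  refine le_trans (le_of_eq ?_) (lintegral_prod_le_one h hT hη g hg D hD)
  refine lintegral_congr fun ω => ?_
  have hN : (occurrences D η ω : ℝ) = ∑ j ∈ D, if patternAt ℓ j ω = η then (1 : ℝ) else 0 := by
    rw [occurrences, Finset.card_filter]; push_cast; rfl
  rw [centred_eq_sum, hN, Finset.mul_sum, Finset.mul_sum, ← Finset.sum_sub_distrib, Real.exp_sum,
    ENNReal.ofReal_prod_of_nonneg fun _ _ => (Real.exp_pos _).le]
  refine Finset.prod_congr rfl fun j _ => ?_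
  split_ifs <;> simp_all [g]
end

/-! ### Splitting the security region into sparse sublattices. -/

section

variable {d : ℕ} {A : Type*}

/-- The representative of `j` modulo `(4R+1) ℤ^d` in the cube of radius `2R`. -/
def residue (R : ℕ) (j : Site d) : Site d := fun i => Int.bmod (j i) (4 * R + 1)

/-- The sites of norm at most `2R`. -/
def residueBox (d R : ℕ) : Finset (Site d) :=
  Finset.Icc (fun _ => -(2 * R : ℤ)) (fun _ => (2 * R : ℤ))

theorem card_residueBox (d R : ℕ) : (residueBox d R).card = (4 * R + 1) ^ d := by
  rw [residueBox, Pi.card_Icc]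
  simp only [Int.card_Icc, Finset.prod_const, Finset.card_univ, Fintype.card_fin]
  congr 1
  omega

theorem mem_residueBox {R : ℕ} {k : Site d} :
    k ∈ residueBox d R ↔ ∀ i, -(2 * R : ℤ) ≤ k i ∧ k i ≤ 2 * R := by
  simp [residueBox, Pi.le_def, forall_and]

theorem norm_le_of_mem_residueBox {R : ℕ} {k : Site d} (hk : k ∈ residueBox d R) :
    ‖k‖ ≤ 2 * (R : ℝ) := by
  refine (pi_norm_le_iff_of_nonneg (by positivity)).2 fun i => ?_
  rw [Int.norm_eq_abs, abs_le]
  have := mem_residueBox.1 hk i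
  exact ⟨by exact_mod_cast this.1, by exact_mod_cast this.2⟩

theorem residue_mem (R : ℕ) (j : Site d) : residue R j ∈ residueBox d R := by
  refine mem_residueBox.2 fun i => ?_
  have h1 := Int.le_bmod (x := j i) (m := 4 * R + 1) (by omega)
  have h2 := Int.bmod_le (x := j i) (m := 4 * R + 1) (by omega)
  simp only [residue]
  push_cast at h1 h2
  omega

/-- The modulus is odd, so balanced remainders range over exactly -2R, ..., 2R in each coordinate.
The sublattices with offset in the box therefore partition ℤ^d. -/
theorem exists_eq_add_smul_iff {R : ℕ} {k : Site d} (hk : k ∈ residueBox d R) (j : Site d) :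
    (∃ l : Site d, j = k + (4 * (R : ℤ) + 1) • l) ↔ residue R j = k := by
  constructor
  · rintro ⟨l, rfl⟩
    funext i
    have := mem_residueBox.1 hk i
    simp only [residue, Pi.add_apply, Pi.smul_apply, smul_eq_mul]
    have h1 : Int.bmod (k i + (4 * (R : ℤ) + 1) * l i) (4 * R + 1) = Int.bmod (k i) (4 * R + 1) := by
      have := Int.add_mul_bmod_self_left (k i) (4 * R + 1) (l i)
      push_cast at this
      exact this
    rw [h1]
    refine Int.bmod_eq_of_le ?_ ?_ <;> push_cast <;> omega
  · intro h
    have h1 : ∀ i, ∃ m : ℤ, j i - k i = (4 * (R : ℤ) + 1) * m := fun i => by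
      have h2 := Int.dvd_self_sub_bmod (x := j i) (m := 4 * R + 1)
      rw [show Int.bmod (j i) (4 * R + 1) = k i from congrFun h i] at h2
      obtain ⟨m, hm⟩ := h2
      exact ⟨m, by rw [hm]; push_cast; rfl⟩
    choose l hl using h1
    refine ⟨l, funext fun i => ?_⟩
    have := hl i
    simp only [Pi.add_apply, Pi.smul_apply, smul_eq_mul]
    omega

theorem sublatticeRegion_eq_filter (Λ : Finset (Site d)) {k : Site d}
    (hk : k ∈ residueBox d (securityDiameter Λ)) :
    sublatticeRegion Λ k =
      (securityRegion Λ).filter fun j => residue (securityDiameter Λ) j = k := by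
  classical
  ext j
  exact Finset.mem_filter.trans
    ((and_congr_right fun _ => exists_eq_add_smul_iff hk j).trans (by rw [Finset.mem_filter]))

theorem lt_norm_sub_of_mem_sublatticeRegion (Λ : Finset (Site d)) (k : Site d) {ℓ : ℕ}
    (hℓ : ℓ ≤ securityDiameter Λ) :
    ∀ i ∈ sublatticeRegion Λ k, ∀ j ∈ sublatticeRegion Λ k, i ≠ j → (ℓ : ℝ) < ‖i - j‖ := by
  classical
  intro i hi j hj hij
  obtain ⟨-, l, hl⟩ := Finset.mem_filter.1 hi
  obtain ⟨-, l', hl'⟩ := Finset.mem_filter.1 hj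
  have hd : i - j = (4 * (securityDiameter Λ : ℤ) + 1) • (l - l') := by
    rw [hl, hl', smul_sub]; abel
  have hll : l - l' ≠ 0 := fun h => hij (sub_eq_zero.1 (by rw [hd, h, smul_zero]))
  obtain ⟨c, hc⟩ := Function.ne_iff.1 hll
  have h1 : (1 : ℤ) ≤ |(l - l') c| := Int.one_le_abs hc
  refine lt_of_lt_of_le ?_ (norm_le_pi_norm (i - j) c)
  rw [hd, Int.norm_eq_abs, Pi.smul_apply, smul_eq_mul]
  have h2 : (ℓ : ℤ) < |(4 * (securityDiameter Λ : ℤ) + 1) * (l - l') c| := by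
    rw [abs_mul, abs_of_nonneg (by positivity : (0 : ℤ) ≤ 4 * (securityDiameter Λ : ℤ) + 1)]
    nlinarith [(by exact_mod_cast hℓ : (ℓ : ℤ) ≤ securityDiameter Λ)]
  exact_mod_cast h2

theorem sum_centred_sublattice (Λ : Finset (Site d)) {ℓ : ℕ} (η : Pattern d A ℓ) (a : A) (p : ℝ)
    (ω : Config d A) :
    ∑ k ∈ residueBox d (securityDiameter Λ), centred (sublatticeRegion Λ k) η a p ω =
      centred (securityRegion Λ) η a p ω := by
  classical
  simp only [centred_eq_sum]
  refine Eq.trans (Finset.sum_congr rfl fun k hk => ?_)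
    (Finset.sum_fiberwise_of_maps_to (fun j _ => residue_mem (securityDiameter Λ) j) _)
  rw [sublatticeRegion_eq_filter Λ hk]

theorem sum_occurrences_sublattice (Λ : Finset (Site d)) {ℓ : ℕ} (η : Pattern d A ℓ)
    (ω : Config d A) :
    ∑ k ∈ residueBox d (securityDiameter Λ), occurrences (sublatticeRegion Λ k) η ω =
      occurrences (securityRegion Λ) η ω := by
  classical
  simp only [occurrences, Finset.card_filter]
  refine Eq.trans (Finset.sum_congr rfl fun k hk => ?_)
    (Finset.sum_fiberwise_of_maps_to (fun j _ => residue_mem (securityDiameter Λ) j) _)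
  rw [sublatticeRegion_eq_filter Λ hk]

/-- Cauchy-Schwarz: passing from the parts to the whole costs only the number of parts under the
root. -/
theorem abs_sum_le_sqrt_of_abs_le {ι : Type*} (K : Finset ι) (S N : ι → ℝ) (T : ℝ) (hT : 0 ≤ T)
    (hN : ∀ k ∈ K, 0 ≤ N k) (h : ∀ k ∈ K, |S k| ≤ Real.sqrt (T * N k)) :
    |∑ k ∈ K, S k| ≤ Real.sqrt (K.card * T * ∑ k ∈ K, N k) := by
  refine Real.le_sqrt_of_sq_le ?_
  rw [sq_abs]
  have h1 : ∑ k ∈ K, S k ^ 2 ≤ ∑ k ∈ K, T * N k := Finset.sum_le_sum fun k hk => by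
    rw [← sq_abs]
    exact (Real.le_sqrt (abs_nonneg _) (mul_nonneg hT (hN k hk))).1 (h k hk)
  rw [mul_assoc, Finset.mul_sum]
  exact sq_sum_le_card_mul_sum_sq.trans (mul_le_mul_of_nonneg_left h1 (Nat.cast_nonneg _))

/-- The exponent 1/(2d) in the definition of R is what makes the number of sublattices O(√L). -/
theorem one_le_of_one_le_securityDiameter {Λ : Finset (Site d)} (hd : 1 ≤ d)
    (hR : 1 ≤ securityDiameter Λ) :
    1 ≤ Real.log (securityRegion Λ).card ∧
      (securityDiameter Λ : ℝ) ^ d ≤ Real.sqrt (Real.log (securityRegion Λ).card) := by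
  have hL0 : 0 ≤ Real.log ((securityRegion Λ).card : ℝ) := Real.log_natCast_nonneg _
  set L := Real.log ((securityRegion Λ).card : ℝ) with hL
  have hle : (securityDiameter Λ : ℝ) ≤ L ^ (1 / (2 * (d : ℝ))) :=
    Nat.floor_le (Real.rpow_nonneg hL0 _)
  have hd0 : (0 : ℝ) < d := by exact_mod_cast hd
  have h2 : (securityDiameter Λ : ℝ) ^ d ≤ Real.sqrt L := by
    calc (securityDiameter Λ : ℝ) ^ d ≤ (L ^ (1 / (2 * (d : ℝ)))) ^ d := by gcongr
      _ = Real.sqrt L := by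
        rw [← Real.rpow_natCast, ← Real.rpow_mul hL0, Real.sqrt_eq_rpow]
        congr 1; field_simp
  refine ⟨?_, h2⟩
  have h3 : (1 : ℝ) ≤ Real.sqrt L :=
    le_trans (one_le_pow₀ (by exact_mod_cast hR)) h2
  exact Real.one_le_sqrt.1 h3

end

/-! ### From a global deviation to a sublattice deviation. -/

section

variable {d : ℕ} {A : Type*} [MeasurableSpace A] [Nonempty A]

/-- On the intersection of the deviation event with the good event, a deviation occurs already on
one of the sublattices. -/
theorem exists_sublattice_deviation (hd : 1 ≤ d) {γ : Specification d A} {Λ : Finset (Site d)}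
    {ℓ : ℕ}
    (hR : 1 ≤ securityDiameter Λ) {δ : ℝ} (hδ : 0 ≤ δ) {a : A} {ω : Config d A}
    (hω : ω ∈ deviationEvent γ Λ ℓ (kappa d δ) a ∩ goodEvent γ Λ ℓ) :
    ∃ η : Pattern d A ℓ, patternLength γ η ≤ ℓ ∧
      ∃ k ∈ residueBox d (securityDiameter Λ),
        0 < occurrences (sublatticeRegion Λ k) η ω ∧
        Real.log (securityRegion Λ).card ≤
          3 / 2 * Real.log (occurrences (sublatticeRegion Λ k) η ω) ∧
        Real.sqrt (δ * Real.sqrt (2 / 3) * Real.sqrt (Real.log (securityRegion Λ).card) *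
          onePointPattern γ a η * occurrences (sublatticeRegion Λ k) η ω) <
          |centred (sublatticeRegion Λ k) η a (onePointPattern γ a η) ω| := by
  obtain ⟨⟨η, hη, hdev⟩, hgood⟩ := hω
  refine ⟨η, hη, ?_⟩
  by_contra! hcon
  obtain ⟨hL1, hRd⟩ := one_le_of_one_le_securityDiameter hd hR
  set L := Real.log ((securityRegion Λ).card : ℝ) with hL
  set R := securityDiameter Λ with hRdef
  set p := onePointPattern γ a η with hp
  have hp0 : 0 ≤ p := onePoint_nonneg γ a _
  have hg : ∀ k ∈ residueBox d R, 0 < occurrences (sublatticeRegion Λ k) η ω ∧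
      L ≤ 3 / 2 * Real.log (occurrences (sublatticeRegion Λ k) η ω : ℝ) := fun k hk =>
    hgood k (norm_le_of_mem_residueBox hk) η hη
  have hS := abs_sum_le_sqrt_of_abs_le (residueBox d R)
    (fun k => centred (sublatticeRegion Λ k) η a p ω)
    (fun k => (occurrences (sublatticeRegion Λ k) η ω : ℝ))
    (δ * Real.sqrt (2 / 3) * Real.sqrt L * p) (by positivity) (fun _ _ => by positivity)
    (fun k hk => hcon k hk (hg k hk).1 (hg k hk).2)
  rw [sum_centred_sublattice, ← Nat.cast_sum, sum_occurrences_sublattice, card_residueBox] at hS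
  have h0 : (0 : Site d) ∈ residueBox d R := mem_residueBox.2 fun i => by simp
  have hle : occurrences (sublatticeRegion Λ 0) η ω ≤ occurrences (securityRegion Λ) η ω := by
    rw [← sum_occurrences_sublattice]
    exact Finset.single_le_sum (f := fun k => occurrences (sublatticeRegion Λ k) η ω)
      (fun _ _ => Nat.zero_le _) h0
  have hN0 : 0 < occurrences (securityRegion Λ) η ω := lt_of_lt_of_le (hg 0 h0).1 hle
  have hLN : L ≤ 3 / 2 * Real.log (occurrences (securityRegion Λ) η ω : ℝ) := by
    refine (hg 0 h0).2.trans ?_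
    have := (hg 0 h0).1
    gcongr
  rw [empirical, if_pos hN0] at hdev
  set N : ℝ := (occurrences (securityRegion Λ) η ω : ℝ) with hN
  have hNpos : 0 < N := Nat.cast_pos.2 hN0
  have hdiv : (occurrencesWith (securityRegion Λ) η a ω : ℝ) / N - p =
      centred (securityRegion Λ) η a p ω / N := by
    rw [centred]; field_simp; rw [← hN]; ring
  rw [hdiv, abs_div, abs_of_pos hNpos, lt_div_iff₀ hNpos] at hdev
  have h1 : Real.sqrt (kappa d δ * p * (Real.log N / N)) * N =
      Real.sqrt (kappa d δ * p * Real.log N * N) := by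
    rw [← Real.sqrt_sq hNpos.le, ← Real.sqrt_mul' _ (sq_nonneg N), Real.sqrt_sq hNpos.le]
    congr 1; field_simp
  rw [h1] at hdev
  refine absurd (hdev.trans_le hS) (not_lt.2 (Real.sqrt_le_sqrt ?_))
  -- The source of κ: 5^d √L sublattices times T gives 5^d δ √(2/3) L, and L ≤ (3/2) log N turns
  -- √(2/3) into √(3/2).
  have h5 : (4 * (R : ℝ) + 1) ^ d ≤ 5 ^ d * Real.sqrt L := by
    calc (4 * (R : ℝ) + 1) ^ d ≤ (5 * R) ^ d := by
          have : (1 : ℝ) ≤ R := by exact_mod_cast hR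
          gcongr; linarith
      _ = 5 ^ d * (R : ℝ) ^ d := mul_pow _ _ _
      _ ≤ _ := by gcongr
  have h23 : Real.sqrt (2 / 3) * (3 / 2) = Real.sqrt (3 / 2) := by
    rw [← Real.sqrt_sq (by norm_num : (0 : ℝ) ≤ 3 / 2), ← Real.sqrt_mul' _ (by norm_num)]
    norm_num
  have hss : Real.sqrt L * Real.sqrt L = L := Real.mul_self_sqrt (by linarith)
  push_cast
  calc (4 * (R : ℝ) + 1) ^ d * (δ * Real.sqrt (2 / 3) * Real.sqrt L * p) * N
      ≤ (5 ^ d * Real.sqrt L) * (δ * Real.sqrt (2 / 3) * Real.sqrt L * p) * N := by gcongr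
    _ = 5 ^ d * δ * Real.sqrt (2 / 3) * p * N * (Real.sqrt L * Real.sqrt L) := by ring
    _ ≤ 5 ^ d * δ * Real.sqrt (2 / 3) * p * N * (3 / 2 * Real.log N) := by
        rw [hss]; gcongr
    _ = 5 ^ d * δ * p * N * Real.log N * (Real.sqrt (2 / 3) * (3 / 2)) := by ring
    _ = kappa d δ * p * Real.log N * N := by rw [h23, kappa]; ring

end

/-! ### Scalar estimates: Bernoulli generating function, block parameter, growth in L. -/

section

/-- The cubic Taylor remainder (2/9)|t|³ is at most t²/40 when |t| ≤ 9/80, and 1/2 + 1/40 = 21/40.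
-/
theorem bernoulli_mgf_le {p t : ℝ} (hp : 0 ≤ p) (ht : |t| ≤ 9 / 80) :
    1 - p + p * Real.exp t ≤ Real.exp (p * t + 21 / 40 * p * t ^ 2) := by
  have h1 := (abs_le.1 (Real.exp_bound (x := t) (by linarith) (n := 3) (by norm_num))).2
  simp only [Finset.sum_range_succ, Finset.sum_range_zero, Nat.factorial] at h1
  norm_num at h1
  have h2 : |t| ^ 3 ≤ 9 / 80 * t ^ 2 := by
    calc |t| ^ 3 = |t| * t ^ 2 := by rw [pow_succ', sq_abs]
      _ ≤ 9 / 80 * t ^ 2 := by gcongr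
  have h3 : Real.exp t ≤ 1 + t + 21 / 40 * t ^ 2 := by linarith
  calc 1 - p + p * Real.exp t ≤ 1 - p + p * (1 + t + 21 / 40 * t ^ 2) := by gcongr
    _ = (p * t + 21 / 40 * p * t ^ 2) + 1 := by ring
    _ ≤ _ := Real.add_one_le_exp _

/-- The parameter of the exponential bound on the block of counts in `[m, 4m)`. -/
def blockParam (T p m : ℝ) : ℝ := min (9 / 80) (2 / 3 * Real.sqrt (T / (p * m)))

theorem blockParam_nonneg (T p m : ℝ) : 0 ≤ blockParam T p m :=
  le_min (by norm_num) (by positivity)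

theorem blockParam_le (T p m : ℝ) : blockParam T p m ≤ 9 / 80 := min_le_left _ _

theorem le_blockParam_exponent {p T m N x : ℝ} (hp : 0 < p) (hT : 0 < T) (hm : 0 < m)
    (hmN : m ≤ N) (hNm : N ≤ 4 * m) (hx : Real.sqrt (T * p * N) ≤ x) :
    min (2 / 5 * T) (27 / 800 * Real.sqrt (T * p * N)) ≤
      blockParam T p m * x - 21 / 40 * p * blockParam T p m ^ 2 * N := by
  have hN : 0 < N := hm.trans_le hmN
  have ht0 := blockParam_nonneg T p m
  have hx' : blockParam T p m * Real.sqrt (T * p * N) ≤ blockParam T p m * x := by gcongr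
  refine le_trans ?_ (sub_le_sub_right hx' _)
  -- If the cap is active, the quadratic term uses at most 7/10 of the linear one, leaving 3/10 ·
  -- 9/80 = 27/800.
  rcases le_total (9 / 80 : ℝ) (2 / 3 * Real.sqrt (T / (p * m))) with hc | hc
  · refine (min_le_right _ _).trans ?_
    have ht : blockParam T p m = 9 / 80 := min_eq_left hc
    rw [ht]
    set y := Real.sqrt (p * N) with hy
    have hy2 : y ^ 2 = p * N := Real.sq_sqrt (by positivity)
    have hs : Real.sqrt (T * p * N) = Real.sqrt T * y := by
      rw [mul_assoc, Real.sqrt_mul hT.le]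
    have hyT : 9 / 80 * y ≤ 4 / 3 * Real.sqrt T := by
      have h1 : y ≤ Real.sqrt (p * (4 * m)) := Real.sqrt_le_sqrt (by gcongr)
      calc 9 / 80 * y ≤ (2 / 3 * Real.sqrt (T / (p * m))) * Real.sqrt (p * (4 * m)) := by gcongr
        _ = 2 / 3 * Real.sqrt (T * 2 ^ 2) := by
          rw [mul_assoc, ← Real.sqrt_mul (by positivity)]
          congr 2; field_simp; norm_num
        _ = 4 / 3 * Real.sqrt T := by
          rw [Real.sqrt_mul hT.le, Real.sqrt_sq (by norm_num)]; ring
    rw [hs, show 21 / 40 * p * (9 / 80 : ℝ) ^ 2 * N = 21 / 40 * (9 / 80) ^ 2 * (p * N) by ring,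
      ← hy2]
    nlinarith [mul_le_mul_of_nonneg_right hyT (Real.sqrt_nonneg (p * N))]
  · refine (min_le_left _ _).trans ?_
    have ht : blockParam T p m = 2 / 3 * Real.sqrt (T / (p * m)) := min_eq_right hc
    rw [ht]
    -- The exponent is T(2r/3 - 7r²/30), concave in r ∈ [1, 2], with smallest value 2T/5 at r = 2.
    set r := Real.sqrt (N / m) with hr
    have hr2 : r ^ 2 = N / m := Real.sq_sqrt (by positivity)
    have hr1 : 1 ≤ r := Real.one_le_sqrt.2 ((one_le_div hm).2 hmN)
    have hr4 : r ≤ 2 := Real.sqrt_le_iff.2 ⟨by norm_num, (div_le_iff₀ hm).2 (by linarith)⟩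
    have e1 : Real.sqrt (T / (p * m)) * Real.sqrt (T * p * N) = T * r := by
      rw [← Real.sqrt_mul (by positivity), hr]
      conv_rhs => rw [← Real.sqrt_sq hT.le, ← Real.sqrt_mul (by positivity)]
      congr 1; field_simp
    have e2 : 21 / 40 * p * (2 / 3 * Real.sqrt (T / (p * m))) ^ 2 * N = 7 / 30 * T * r ^ 2 := by
      rw [mul_pow, Real.sq_sqrt (by positivity), hr2]; field_simp; norm_num
    rw [e2, mul_assoc, e1]
    nlinarith [mul_nonneg hT.le (mul_nonneg (sub_nonneg.2 hr1) (sub_nonneg.2 hr4))]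

/-- With α = log|A| this is the entropy of the patterns plus the logarithm of the number of blocks.
The two terms take 6/5 and 1/20 of 2^d α √L. -/
theorem eventually_volume_bound {d : ℕ} (hd : 1 ≤ d) {α : ℝ} (hα : 0 < α) :
    ∀ᶠ L : ℝ in Filter.atTop,
      α * (2 * L ^ (1 / (2 * (d : ℝ))) + 1) ^ d + Real.log (L + 1) ≤
        5 / 4 * (2 ^ d * α) * Real.sqrt L := by
  have hd0 : (0 : ℝ) < d := by exact_mod_cast hd
  have hx : Filter.Tendsto (fun L : ℝ => L ^ (1 / (2 * (d : ℝ)))) Filter.atTop Filter.atTop :=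
    tendsto_rpow_atTop (by positivity)
  have h1 : ∀ᶠ L : ℝ in Filter.atTop,
      (2 + (L ^ (1 / (2 * (d : ℝ))))⁻¹) ^ d ≤ 6 / 5 * (2 : ℝ) ^ d := by
    have := ((tendsto_inv_atTop_zero.comp hx).const_add (2 : ℝ)).pow d
    rw [add_zero] at this
    refine (this.eventually_lt_const ?_).mono fun L h => h.le
    have : (0 : ℝ) < 2 ^ d := by positivity
    linarith
  have h2 : ∀ᶠ L : ℝ in Filter.atTop,
      Real.log (L + 1) ≤ 1 / 40 * (2 ^ d * α) * Real.sqrt (L + 1) := by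
    have h3 := (isLittleO_log_rpow_atTop (show (0 : ℝ) < 1 / 2 by norm_num)).def
      (show 0 < 1 / 40 * (2 ^ d * α) by positivity)
    have h4 := (Filter.tendsto_atTop_add_const_right Filter.atTop (1 : ℝ)
      Filter.tendsto_id).eventually h3
    filter_upwards [h4] with L hL
    simp only [id] at hL
    rw [← Real.sqrt_eq_rpow, Real.norm_of_nonneg (Real.sqrt_nonneg _)] at hL
    exact (le_abs_self _).trans hL
  filter_upwards [h1, h2, Filter.eventually_ge_atTop 1] with L hL1 hL2 hL
  have hL0 : 0 < L := by linarith
  set x := L ^ (1 / (2 * (d : ℝ))) with hxdef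
  have hx0 : 0 < x := Real.rpow_pos_of_pos hL0 _
  have hxd : x ^ d = Real.sqrt L := by
    rw [hxdef, ← Real.rpow_natCast, ← Real.rpow_mul hL0.le, Real.sqrt_eq_rpow]
    congr 1; field_simp
  have h5 : (2 * x + 1) ^ d ≤ 6 / 5 * 2 ^ d * Real.sqrt L := by
    calc (2 * x + 1) ^ d = (2 + x⁻¹) ^ d * x ^ d := by rw [← mul_pow]; congr 1; field_simp
      _ ≤ 6 / 5 * 2 ^ d * x ^ d := by gcongr
      _ = _ := by rw [hxd]
  have h6 : Real.sqrt (L + 1) ≤ 2 * Real.sqrt L := by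
    refine Real.sqrt_le_iff.2 ⟨by positivity, ?_⟩
    rw [mul_pow, Real.sq_sqrt hL0.le]; linarith
  have h7 : Real.log (L + 1) ≤ 1 / 40 * (2 ^ d * α) * (2 * Real.sqrt L) :=
    hL2.trans (by gcongr)
  nlinarith [mul_le_mul_of_nonneg_left h5 hα.le]

/-- Keeps the capped regime of `blockParam` harmless. Only B enters, so the threshold for L is
uniform in γ, μ and δ. -/
theorem eventually_sqrt_le_exp {B : ℝ} (hB : 0 < B) :
    ∀ᶠ L : ℝ in Filter.atTop,
      13 / 10 * B * Real.sqrt L ≤ 27 / 800 * Real.sqrt (B * Real.exp (2 / 3 * L)) := by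
  filter_upwards [Filter.eventually_ge_atTop 1,
    Filter.eventually_ge_atTop (13 / 10 * 18 * 800 / 27 * Real.sqrt B)] with L hL1 hLB
  have hs : Real.sqrt (B * Real.exp (2 / 3 * L)) = Real.sqrt B * Real.exp (L / 3) := by
    rw [Real.sqrt_mul hB.le, ← Real.sqrt_sq (Real.exp_pos (L / 3)).le, ← Real.exp_nat_mul]
    congr 3; push_cast; ring
  have hq := Real.quadratic_le_exp_of_nonneg (show 0 ≤ L / 3 by linarith)
  have hsL : Real.sqrt L ≤ L := Real.sqrt_le_iff.2 ⟨by linarith, by nlinarith⟩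
  have hb : 0 < Real.sqrt B := Real.sqrt_pos.2 hB
  have hBB : B = Real.sqrt B * Real.sqrt B := (Real.mul_self_sqrt hB.le).symm
  rw [hs]
  calc 13 / 10 * B * Real.sqrt L ≤ 13 / 10 * B * L := by gcongr
    _ = 13 / 10 * Real.sqrt B * Real.sqrt B * L := by
        rw [mul_assoc (13 / 10 : ℝ) (Real.sqrt B), ← hBB]
    _ ≤ 27 / 800 * Real.sqrt B * (L * L / 18) := by
        nlinarith [mul_le_mul_of_nonneg_left hLB (show 0 ≤ Real.sqrt B * L by positivity)]
    _ ≤ 27 / 800 * Real.sqrt B * Real.exp (L / 3) := by gcongr; nlinarith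
    _ = _ := by ring

end

/-! ### Tail bound for one pattern on one sparse set. -/

section

variable {d : ℕ} {A : Type*}

theorem occurrences_le_card (D : Finset (Site d)) {ℓ : ℕ} (η : Pattern d A ℓ) (ω : Config d A) :
    occurrences D η ω ≤ D.card := by
  classical
  exact Finset.card_filter_le _ _

variable [MeasurableSpace A]

theorem measurable_occurrences [MeasurableSingletonClass A] (D : Finset (Site d)) {ℓ : ℕ}
    (η : Pattern d A ℓ) : Measurable fun ω : Config d A => (occurrences D η ω : ℝ) := by
  classical
  have : (fun ω : Config d A => (occurrences D η ω : ℝ)) =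
      fun ω => ∑ j ∈ D, if patternAt ℓ j ω = η then (1 : ℝ) else 0 := by
    funext ω
    rw [occurrences, Finset.card_filter]; push_cast; rfl
  rw [this]
  exact Finset.measurable_sum _ fun j _ => Measurable.ite
    ((measurable_patternAt ℓ j) (measurableSet_singleton η)) measurable_const measurable_const

theorem measurable_centred [MeasurableSingletonClass A] (D : Finset (Site d)) {ℓ : ℕ}
    (η : Pattern d A ℓ) (a : A) (p : ℝ) : Measurable fun ω : Config d A => centred D η a p ω := by
  classical
  simp only [centred_eq_sum]
  have hS : ∀ j : Site d, MeasurableSet {ω : Config d A | ω j = a} := fun j =>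
    measurable_pi_apply (X := fun _ : Site d => A) j (measurableSet_singleton a)
  exact Finset.measurable_sum _ fun j _ => Measurable.ite
    ((measurable_patternAt ℓ j) (measurableSet_singleton η))
    ((Measurable.ite (hS j) measurable_const measurable_const).sub_const p) measurable_const

variable [Nonempty A] [Fintype A] [DiscreteMeasurableSpace A] {γ : Specification d A}
    {μ : Measure (Config d A)} [IsProbabilityMeasure μ]

/-- Markov's inequality for the exponential bound; the random count N stays inside the event as
compensator. -/
theorem measure_exponent_ge_le (h : IsVariableNeighborhoodField γ μ)
    (hT : IsTranslationCovariant γ) {ℓ : ℕ} {η : Pattern d A ℓ} (hη : patternLength γ η ≤ ℓ)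
    (D : Finset (Site d)) (hD : ∀ i ∈ D, ∀ j ∈ D, i ≠ j → (ℓ : ℝ) < ‖i - j‖) (a : A) {t : ℝ}
    (ht : |t| ≤ 9 / 80) (V : ℝ) :
    μ {ω | V ≤ t * centred D η a (onePointPattern γ a η) ω -
      21 / 40 * onePointPattern γ a η * t ^ 2 * occurrences D η ω} ≤
      ENNReal.ofReal (Real.exp (-V)) := by
  set p := onePointPattern γ a η with hp
  have hp0 : 0 ≤ p := onePoint_nonneg γ a _
  have h1 := lintegral_exp_centred_le_one h hT hη D hD a t (21 / 40 * p * t ^ 2)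
    (bernoulli_mgf_le hp0 ht)
  have hm : Measurable fun ω : Config d A => ENNReal.ofReal (Real.exp (t * centred D η a p ω -
      21 / 40 * p * t ^ 2 * occurrences D η ω)) :=
    (Real.measurable_exp.comp (((measurable_centred D η a p).const_mul t).sub
      ((measurable_occurrences D η).const_mul _))).ennreal_ofReal
  have h2 := (mul_meas_ge_le_lintegral₀ hm.aemeasurable
    (ENNReal.ofReal (Real.exp V))).trans h1
  have h3 : {ω : Config d A | V ≤ t * centred D η a p ω -
      21 / 40 * p * t ^ 2 * occurrences D η ω} ⊆
      {ω | ENNReal.ofReal (Real.exp V) ≤ ENNReal.ofReal (Real.exp (t * centred D η a p ω -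
        21 / 40 * p * t ^ 2 * occurrences D η ω))} := fun ω hω =>
    ENNReal.ofReal_le_ofReal (Real.exp_le_exp.2 hω)
  have h4 : ENNReal.ofReal (Real.exp (-V)) * ENNReal.ofReal (Real.exp V) = 1 := by
    rw [← ENNReal.ofReal_mul (Real.exp_pos _).le, ← Real.exp_add]; simp
  refine (measure_mono h3).trans ?_
  rw [← one_mul (μ _), ← h4, mul_assoc]
  exact (mul_le_mul' le_rfl h2).trans (mul_one _).le

/-- Maximal inequality for one pattern and one sparse set of sites: the number of occurrences is
not fixed, but at least `exp (2 L / 3)`. -/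
theorem measure_sparse_deviation_le (h : IsVariableNeighborhoodField γ μ)
    (hT : IsTranslationCovariant γ) {ℓ : ℕ} {η : Pattern d A ℓ} (hη : patternLength γ η ≤ ℓ)
    (D : Finset (Site d)) (hD : ∀ i ∈ D, ∀ j ∈ D, i ≠ j → (ℓ : ℝ) < ‖i - j‖) (a : A)
    {M : ℕ} (hM : D.card ≤ M) {T L V : ℝ} (hT0 : 0 < T) (hp0 : 0 < onePointPattern γ a η)
    (hV1 : V ≤ 2 / 5 * T)
    (hV2 : V ≤ 27 / 800 * Real.sqrt (T * onePointPattern γ a η * Real.exp (2 / 3 * L))) :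
    μ {ω | 0 < occurrences D η ω ∧ L ≤ 3 / 2 * Real.log (occurrences D η ω) ∧
      Real.sqrt (T * onePointPattern γ a η * occurrences D η ω) <
        |centred D η a (onePointPattern γ a η) ω|} ≤
      (Nat.log 4 M + 1 : ℕ) * (2 * ENNReal.ofReal (Real.exp (-V))) := by
  set p := onePointPattern γ a η with hp
  let t : ℕ → ℝ := fun s => blockParam T p (4 ^ s)
  let E : ℝ → Set (Config d A) := fun t =>
    {ω | V ≤ t * centred D η a p ω - 21 / 40 * p * t ^ 2 * occurrences D η ω}
  have hsub : {ω : Config d A | 0 < occurrences D η ω ∧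
      L ≤ 3 / 2 * Real.log (occurrences D η ω) ∧
      Real.sqrt (T * p * occurrences D η ω) < |centred D η a p ω|} ⊆
      ⋃ s ∈ Finset.range (Nat.log 4 M + 1), (E (t s) ∪ E (-t s)) := by
    rintro ω ⟨hN, hL, hdev⟩
    set N := occurrences D η ω with hNdef
    have hN0 : (0 : ℝ) < N := Nat.cast_pos.2 hN
    have hNe : Real.exp (2 / 3 * L) ≤ N := by
      rw [← Real.le_log_iff_exp_le hN0]; linarith
    -- N lies in the block [4^s, 4^(s+1)) with s = `Nat.log 4 N`, so the parameter of that block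
    -- applies.
    refine Set.mem_biUnion (x := Nat.log 4 N) (Finset.mem_coe.2 (Finset.mem_range.2
      (Nat.lt_succ_of_le (Nat.log_mono_right ((occurrences_le_card D η ω).trans hM))))) ?_
    have hm1 : ((4 : ℝ) ^ Nat.log 4 N) ≤ N := by
      exact_mod_cast Nat.pow_log_le_self 4 hN.ne'
    have hm2 : (N : ℝ) ≤ 4 * 4 ^ Nat.log 4 N := by
      have := (Nat.lt_pow_succ_log_self (b := 4) (by norm_num) N).le
      rw [pow_succ'] at this
      exact_mod_cast this
    have key := le_blockParam_exponent hp0 hT0 (by positivity) hm1 hm2 hdev.le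
    have hV : V ≤ t (Nat.log 4 N) * |centred D η a p ω| -
        21 / 40 * p * t (Nat.log 4 N) ^ 2 * N := by
      refine le_trans (le_min hV1 (hV2.trans ?_)) key
      gcongr
    rcases abs_cases (centred D η a p ω) with hc | hc
    · left
      rw [hc.1] at hV
      exact hV
    · right
      rw [hc.1] at hV
      show V ≤ _
      rw [neg_sq, neg_mul, ← mul_neg]
      exact hV
  have hE : ∀ s, μ (E (t s) ∪ E (-t s)) ≤ 2 * ENNReal.ofReal (Real.exp (-V)) := fun s => by
    have ht : |t s| ≤ 9 / 80 := by
      rw [abs_of_nonneg (blockParam_nonneg _ _ _)]; exact blockParam_le _ _ _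
    rw [two_mul]
    exact (measure_union_le _ _).trans (add_le_add
      (measure_exponent_ge_le h hT hη D hD a ht V)
      (measure_exponent_ge_le h hT hη D hD a (by rwa [abs_neg]) V))
  calc _ ≤ μ (⋃ s ∈ Finset.range (Nat.log 4 M + 1), (E (t s) ∪ E (-t s))) := measure_mono hsub
    _ ≤ ∑ s ∈ Finset.range (Nat.log 4 M + 1), μ (E (t s) ∪ E (-t s)) :=
        measure_biUnion_finset_le _ _
    _ ≤ ∑ _s ∈ Finset.range (Nat.log 4 M + 1), 2 * ENNReal.ofReal (Real.exp (-V)) :=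
        Finset.sum_le_sum fun s _ => hE s
    _ = _ := by rw [Finset.sum_const, Finset.card_range, nsmul_eq_mul]

end

/-! ### Numerical constants and the union bound. -/

section

/-- The lower bound on `δ` makes the Gaussian exponent exceed the entropy of the patterns. -/
theorem le_exponent_constants {q δ s : ℝ} (hq : 0 < q) (hq2 : q ≤ 1 / 2) {B : ℝ} (hB : 0 < B)
    (hδ : B * (3 * Real.exp 1 / (4 * q)) < δ) (hs : 1 ≤ s) :
    13 / 10 * B * s ≤ 2 / 5 * (δ * Real.sqrt (2 / 3) * s) ∧
      B ≤ δ * Real.sqrt (2 / 3) * s * q := by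
  have he : (2.718 : ℝ) ≤ Real.exp 1 := le_trans (by norm_num) Real.exp_one_gt_d9.le
  have h23 : (0.816 : ℝ) ≤ Real.sqrt (2 / 3) := Real.le_sqrt_of_sq_le (by norm_num)
  -- 2.038 is just below (3/4)e. With q ≤ 1/2 it doubles to 4.076, and 4.076 · 0.816 · 2/5 is
  -- slightly above 13/10.
  have hδq : B * 2.038 ≤ δ * q := by
    have h1 : B * (3 * Real.exp 1 / (4 * q)) * q = B * (3 / 4 * Real.exp 1) := by
      field_simp
    have h2 : B * (3 * Real.exp 1 / (4 * q)) * q ≤ δ * q := by gcongr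
    rw [h1] at h2
    refine le_trans ?_ h2
    gcongr
    linarith
  have hδ0 : 0 < δ := lt_of_le_of_lt (by positivity) hδ
  have hδ4 : B * 4.076 ≤ δ := by nlinarith
  constructor
  · have h1 : (B * 4.076) * 0.816 ≤ δ * Real.sqrt (2 / 3) := by gcongr
    have h2 : 13 / 10 * B ≤ 2 / 5 * (δ * Real.sqrt (2 / 3)) := by linarith
    calc 13 / 10 * B * s ≤ 2 / 5 * (δ * Real.sqrt (2 / 3)) * s := by gcongr
      _ = _ := by ring
  · calc B ≤ B * 2.038 * 0.816 * 1 := by linarith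
      _ ≤ δ * q * Real.sqrt (2 / 3) * s := by gcongr
      _ = _ := by ring

variable {d : ℕ} {A : Type*}

theorem puncturedCube_subset_Icc (ℓ : ℕ) :
    puncturedCube (0 : Site d) (ℓ : ℝ) ⊆
      ((Finset.Icc (fun _ => -(ℓ : ℤ)) (fun _ => (ℓ : ℤ)) : Finset (Site d)) : Set (Site d)) := by
  intro m hm
  have h1 : ‖m‖ ≤ (ℓ : ℝ) := by simpa [cube] using hm.1
  rw [Finset.coe_Icc, Set.mem_Icc]
  have h2 : ∀ i, |m i| ≤ (ℓ : ℤ) := fun i => by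
    have := (norm_le_pi_norm m i).trans h1
    rw [Int.norm_eq_abs] at this
    exact_mod_cast this
  exact ⟨fun i => (abs_le.1 (h2 i)).1, fun i => (abs_le.1 (h2 i)).2⟩

instance (ℓ : ℕ) : Finite (puncturedCube (0 : Site d) (ℓ : ℝ)) :=
  (Finset.finite_toSet _).subset (puncturedCube_subset_Icc ℓ)

theorem card_pattern_le [Finite A] [Nonempty A] (ℓ : ℕ) :
    Nat.card (Pattern d A ℓ) ≤ Nat.card A ^ (2 * ℓ + 1) ^ d := by
  rw [Nat.card_fun]
  refine Nat.pow_le_pow_right Nat.card_pos ?_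
  have h1 := Set.ncard_le_ncard (puncturedCube_subset_Icc (d := d) ℓ) (Finset.finite_toSet _)
  rw [Set.ncard_coe_finset, Pi.card_Icc] at h1
  simp only [Int.card_Icc, Finset.prod_const, Finset.card_univ, Fintype.card_fin] at h1
  refine h1.trans (le_of_eq ?_)
  congr 1
  omega

variable [MeasurableSpace A] [Fintype A] [Nonempty A] [DiscreteMeasurableSpace A]
  {γ : Specification d A} {μ : Measure (Config d A)}

/-- With a single symbol log|A| = 0 and the exponents degenerate, but p = 1 and every centred count
vanishes. -/
theorem deviationEvent_inter_goodEvent_eq_empty [Subsingleton A] (hd : 1 ≤ d)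
    {Λ : Finset (Site d)} {ℓ : ℕ} (hR : 1 ≤ securityDiameter Λ) {δ : ℝ} (hδ : 0 ≤ δ) (a : A) :
    deviationEvent γ Λ ℓ (kappa d δ) a ∩ goodEvent γ Λ ℓ = ∅ := by
  classical
  refine Set.eq_empty_of_forall_notMem fun ω hω => ?_
  obtain ⟨η, -, k, -, -, -, h⟩ := exists_sublattice_deviation hd hR hδ hω
  have hp : onePointPattern γ a η = 1 := by
    have := sum_onePoint γ (extend η)
    rwa [Fintype.sum_subsingleton _ a] at this
  have h0 : centred (sublatticeRegion Λ k) η a (onePointPattern γ a η) ω = 0 := by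
    rw [centred_eq_sum, hp]
    exact Finset.sum_eq_zero fun j _ => by simp [Subsingleton.elim (ω j) a]
  rw [h0, abs_zero] at h
  exact absurd h (not_lt.2 (Real.sqrt_nonneg _))

theorem measureReal_deviation_le [Nontrivial A] [IsProbabilityMeasure μ] (hd : 1 ≤ d)
    (h : IsVariableNeighborhoodField γ μ) (hT : IsTranslationCovariant γ) (hq : 0 < qMin γ)
    {δ : ℝ}
    (hδ : 2 ^ d * Real.log (Fintype.card A : ℝ) * (3 * Real.exp 1 / (4 * qMin γ)) < δ)
    {Λ : Finset (Site d)} {ℓ : ℕ} (hR : 1 ≤ securityDiameter Λ) (hℓ : ℓ ≤ securityDiameter Λ)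
    (a : A) {L : ℝ} (hL : L = Real.log ((securityRegion Λ).card : ℝ))
    (h1 : Real.log (Fintype.card A : ℝ) * (2 * L ^ (1 / (2 * (d : ℝ))) + 1) ^ d +
      Real.log (L + 1) ≤ 5 / 4 * (2 ^ d * Real.log (Fintype.card A : ℝ)) * Real.sqrt L)
    (h2 : 13 / 10 * (2 ^ d * Real.log (Fintype.card A : ℝ)) * Real.sqrt L ≤
      27 / 800 * Real.sqrt (2 ^ d * Real.log (Fintype.card A : ℝ) * Real.exp (2 / 3 * L))) :
    μ.real (deviationEvent γ Λ ℓ (kappa d δ) a ∩ goodEvent γ Λ ℓ) ≤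
      2 * (4 * (securityDiameter Λ : ℝ) + 1) ^ d *
        Real.exp (-(1 / 20 * (2 ^ d * Real.log (Fintype.card A : ℝ))) * Real.sqrt L) := by
  classical
  have := Fintype.ofFinite (Pattern d A ℓ)
  have hc : (1 : ℝ) < Fintype.card A := by exact_mod_cast Fintype.one_lt_card (α := A)
  set α := Real.log (Fintype.card A : ℝ) with hα
  have hα0 : 0 < α := Real.log_pos hc
  set B := 2 ^ d * α with hB
  have hB0 : 0 < B := by positivity
  have hδ0 : 0 < δ := lt_of_le_of_lt (by positivity) hδ
  obtain ⟨hL1, -⟩ := one_le_of_one_le_securityDiameter hd hR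
  rw [← hL] at hL1
  have hs1 : 1 ≤ Real.sqrt L := Real.one_le_sqrt.2 hL1
  have hc2 : (2 : ℝ) ≤ Fintype.card A := by exact_mod_cast Fintype.one_lt_card (α := A)
  have hq2 : qMin γ ≤ 1 / 2 := by nlinarith [card_mul_qMin_le_one γ]
  obtain ⟨hV1, hV2⟩ := le_exponent_constants hq hq2 hB0 hδ hs1
  set R := securityDiameter Λ with hRdef
  -- Patterns and blocks together cost 5/4 · B √L, so 1/20 · B √L of the exponent survives.
  set V := 13 / 10 * B * Real.sqrt L with hV
  set T := δ * Real.sqrt (2 / 3) * Real.sqrt L with hTdef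
  have hT0 : 0 < T := by positivity
  set M := (securityRegion Λ).card with hM
  have hMpos : 0 < M := by
    rcases Nat.eq_zero_or_pos M with h0 | h0
    · rw [h0] at hL; norm_num at hL; linarith
    · exact h0
  let E : Pattern d A ℓ → Site d → Set (Config d A) := fun η k =>
    {ω | 0 < occurrences (sublatticeRegion Λ k) η ω ∧
      L ≤ 3 / 2 * Real.log (occurrences (sublatticeRegion Λ k) η ω) ∧
      Real.sqrt (T * onePointPattern γ a η * occurrences (sublatticeRegion Λ k) η ω) <
        |centred (sublatticeRegion Λ k) η a (onePointPattern γ a η) ω|}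
  have hsub : deviationEvent γ Λ ℓ (kappa d δ) a ∩ goodEvent γ Λ ℓ ⊆
      ⋃ x ∈ (Finset.univ.filter fun η : Pattern d A ℓ => patternLength γ η ≤ ℓ) ×ˢ
        residueBox d R, E x.1 x.2 := by
    intro ω hω
    obtain ⟨η, hη, k, hk, hN, hLN, hdev⟩ := exists_sublattice_deviation hd hR hδ0.le hω
    refine Set.mem_biUnion (x := (η, k)) ?_ ⟨hN, hL ▸ hLN, ?_⟩
    · simpa [hη] using hk
    · rw [hTdef, hL]; exact hdev
  have hE : ∀ x ∈ (Finset.univ.filter fun η : Pattern d A ℓ => patternLength γ η ≤ ℓ) ×ˢ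
      residueBox d R, μ.real (E x.1 x.2) ≤ (L + 1) * (2 * Real.exp (-V)) := by
    intro x hx
    have hη : patternLength γ x.1 ≤ ℓ := by simpa using (Finset.mem_product.1 hx).1
    have hqp : qMin γ ≤ onePointPattern γ a x.1 := qMin_le_onePoint γ a _
    have h3 := measure_sparse_deviation_le h hT hη (sublatticeRegion Λ x.2)
      (lt_norm_sub_of_mem_sublatticeRegion Λ x.2 hℓ) a (M := M) (T := T) (L := L) (V := V)
      (by classical exact Finset.card_filter_le _ _) hT0 (hq.trans_le hqp) hV1
      -- T p ≥ B removes δ and γ from the capped regime, reducing it to `h2`.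
      (h2.trans (by
        have : B ≤ T * onePointPattern γ a x.1 := hV2.trans (by gcongr)
        gcongr))
    have h4 := ENNReal.toReal_mono (by finiteness) h3
    refine h4.trans ?_
    rw [ENNReal.toReal_mul, ENNReal.toReal_mul, ENNReal.toReal_ofReal (Real.exp_pos _).le,
      ENNReal.toReal_natCast, ENNReal.toReal_ofNat]
    have h5 : (Nat.log 4 M : ℝ) ≤ L := by
      have h6 : ((4 : ℝ) ^ Nat.log 4 M) ≤ M := by
        exact_mod_cast Nat.pow_log_le_self 4 hMpos.ne'
      have h7 := Real.log_le_log (by positivity) h6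
      rw [Real.log_pow, ← hL] at h7
      have h8 : 1 ≤ Real.log 4 := by
        rw [Real.le_log_iff_exp_le (by norm_num)]
        exact Real.exp_one_lt_d9.le.trans (by norm_num)
      nlinarith [(Nat.cast_nonneg (Nat.log 4 M) : (0 : ℝ) ≤ _)]
    push_cast
    gcongr
  have hcardP : (Fintype.card (Pattern d A ℓ) : ℝ) * (L + 1) ≤ Real.exp (5 / 4 * B * Real.sqrt L) := by
    have h3 : (Fintype.card (Pattern d A ℓ) : ℝ) ≤
        Real.exp (α * (2 * L ^ (1 / (2 * (d : ℝ))) + 1) ^ d) := by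
      have h4 := card_pattern_le (d := d) (A := A) ℓ
      rw [Nat.card_eq_fintype_card, Nat.card_eq_fintype_card] at h4
      have h5 : (Fintype.card (Pattern d A ℓ) : ℝ) ≤ (Fintype.card A : ℝ) ^ (2 * ℓ + 1) ^ d := by
        exact_mod_cast h4
      refine h5.trans ?_
      rw [← Real.rpow_natCast, Real.rpow_def_of_pos (by linarith)]
      have h6 : (ℓ : ℝ) ≤ L ^ (1 / (2 * (d : ℝ))) := by
        refine le_trans (b := (R : ℝ)) (by exact_mod_cast hℓ) ?_
        rw [hRdef, securityDiameter, ← hM, ← hL]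
        exact Nat.floor_le (Real.rpow_nonneg (by linarith) _)
      push_cast
      gcongr
    calc (Fintype.card (Pattern d A ℓ) : ℝ) * (L + 1)
        ≤ Real.exp (α * (2 * L ^ (1 / (2 * (d : ℝ))) + 1) ^ d) * Real.exp (Real.log (L + 1)) := by
          rw [Real.exp_log (by linarith)]; gcongr
      _ ≤ _ := by rw [← Real.exp_add]; exact Real.exp_le_exp.2 h1
  have hcardF : (((Finset.univ.filter fun η : Pattern d A ℓ => patternLength γ η ≤ ℓ) ×ˢ
      residueBox d R).card : ℝ) ≤ Fintype.card (Pattern d A ℓ) * (4 * (R : ℝ) + 1) ^ d := by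
    rw [Finset.card_product, card_residueBox]
    push_cast
    gcongr
    exact Finset.card_filter_le _ _
  calc μ.real (deviationEvent γ Λ ℓ (kappa d δ) a ∩ goodEvent γ Λ ℓ)
      ≤ μ.real (⋃ x ∈ (Finset.univ.filter fun η : Pattern d A ℓ => patternLength γ η ≤ ℓ) ×ˢ
        residueBox d R, E x.1 x.2) := measureReal_mono hsub (measure_ne_top _ _)
    _ ≤ ∑ x ∈ (Finset.univ.filter fun η : Pattern d A ℓ => patternLength γ η ≤ ℓ) ×ˢ
        residueBox d R, μ.real (E x.1 x.2) := measureReal_biUnion_finset_le _ _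
    _ ≤ _ := Finset.sum_le_card_nsmul _ _ _ hE
    _ ≤ Fintype.card (Pattern d A ℓ) * (4 * (R : ℝ) + 1) ^ d *
        ((L + 1) * (2 * Real.exp (-V))) := by
        rw [nsmul_eq_mul]; gcongr
    _ = 2 * (4 * (R : ℝ) + 1) ^ d *
        ((Fintype.card (Pattern d A ℓ) * (L + 1)) * Real.exp (-V)) := by ring
    _ ≤ 2 * (4 * (R : ℝ) + 1) ^ d *
        (Real.exp (5 / 4 * B * Real.sqrt L) * Real.exp (-V)) := by gcongr
    _ = _ := by rw [← Real.exp_add, hV]; congr 2; ring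

end

end VNField

end

/-! ### Choice of the constants. -/

theorem theorem5p1 (d : ℕ) (hd : 1 ≤ d) (A : Type*) [Fintype A] [Nonempty A]
    [MeasurableSpace A] [DiscreteMeasurableSpace A] :
    ∃ c : ℝ → ℝ → ℝ,
      ∀ Λ : ℕ → Finset (VNField.Site d), Monotone Λ →
        (∀ Δ : Finset (VNField.Site d), ∃ n, Δ ⊆ Λ n) →
      ∃ n₀ : ℕ,
        ∀ (γ : VNField.Specification d A) (μ : MeasureTheory.Measure (VNField.Config d A)),
          MeasureTheory.IsProbabilityMeasure μ →
          VNField.IsVariableNeighborhoodField γ μ →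
          VNField.IsTranslationCovariant γ →
          0 < VNField.qMin γ →
        ∀ δ : ℝ,
          2 ^ d * Real.log (Fintype.card A : ℝ) * (3 * Real.exp 1 / (4 * VNField.qMin γ)) < δ →
          0 < c δ (VNField.qMin γ) ∧
          ∀ n : ℕ, n₀ ≤ n → ∀ ℓ : ℕ, 1 ≤ ℓ → ℓ ≤ VNField.securityDiameter (Λ n) → ∀ a : A,
            μ.real (VNField.deviationEvent γ (Λ n) ℓ (VNField.kappa d δ) a ∩
                VNField.goodEvent γ (Λ n) ℓ) ≤
              4 * (4 * (VNField.securityDiameter (Λ n) : ℝ) + 1) ^ d *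
                Real.exp (-(c δ (VNField.qMin γ)) *
                  Real.sqrt (Real.log ((VNField.securityRegion (Λ n)).card : ℝ))) := by
  have hα : 0 ≤ Real.log (Fintype.card A : ℝ) := Real.log_natCast_nonneg _
  rcases subsingleton_or_nontrivial A with hA | hA
  · refine ⟨fun _ _ => 1, fun Λ _ _ => ⟨0, fun γ μ _ _ _ hq δ hδ => ⟨one_pos, ?_⟩⟩⟩
    intro n _ ℓ hℓ1 hℓ a
    have hδ0 : 0 ≤ δ := le_of_lt (lt_of_le_of_lt (by positivity) hδ)
    rw [VNField.deviationEvent_inter_goodEvent_eq_empty hd (hℓ1.trans hℓ) hδ0 a]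
    simp only [MeasureTheory.measureReal_empty]
    positivity
  have hα0 : 0 < Real.log (Fintype.card A : ℝ) :=
    Real.log_pos (by exact_mod_cast Fintype.one_lt_card (α := A))
  have hB0 : 0 < 2 ^ d * Real.log (Fintype.card A : ℝ) := by positivity
  obtain ⟨L₀, hL₀⟩ := Filter.eventually_atTop.1
    (((VNField.eventually_volume_bound hd hα0).and (VNField.eventually_sqrt_le_exp hB0)).and
      (Filter.eventually_ge_atTop 1))
  have hL₀1 : 1 ≤ L₀ := (hL₀ L₀ le_rfl).2
  -- The second term absorbs small L: for L ≤ L₀ it gives c √L ≤ 1, so the right-hand side is at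
  -- least 4/e > 1 and the bound is trivial. Hence `n₀ = 0` works, and `c` can be constant in δ and
  -- q_min.
  set c := min (1 / 20 * (2 ^ d * Real.log (Fintype.card A : ℝ))) (1 / Real.sqrt L₀) with hc
  have hs0 : 0 < Real.sqrt L₀ := Real.sqrt_pos.2 (by linarith)
  have hc0 : 0 < c := lt_min (by positivity) (by positivity)
  refine ⟨fun _ _ => c, fun Λ _ _ => ⟨0, fun γ μ hμ h hT hq δ hδ => ⟨hc0, ?_⟩⟩⟩
  intro n _ ℓ hℓ1 hℓ a
  set L := Real.log ((VNField.securityRegion (Λ n)).card : ℝ) with hL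
  rcases le_total L₀ L with hLL | hLL
  · obtain ⟨⟨h1, h2⟩, -⟩ := hL₀ L hLL
    refine (VNField.measureReal_deviation_le hd h hT hq hδ (hℓ1.trans hℓ) hℓ a hL h1 h2).trans ?_
    have : c ≤ 1 / 20 * (2 ^ d * Real.log (Fintype.card A : ℝ)) := min_le_left _ _
    gcongr
    norm_num
  · refine MeasureTheory.measureReal_le_one.trans ?_
    have h1 : c * Real.sqrt L ≤ 1 := by
      calc c * Real.sqrt L ≤ 1 / Real.sqrt L₀ * Real.sqrt L₀ := by
            gcongr
            exact min_le_right _ _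
        _ = 1 := by field_simp
    have h2 : 0 ≤ 1 - c * Real.sqrt L := by linarith
    have h3 : (1 : ℝ) ≤ (4 * (VNField.securityDiameter (Λ n) : ℝ) + 1) ^ d :=
      one_le_pow₀ (by linarith [(Nat.cast_nonneg (VNField.securityDiameter (Λ n)) : (0 : ℝ) ≤ _)])
    have h4 : (1 / 4 : ℝ) ≤ Real.exp (-1) := by
      rw [Real.exp_neg, ← one_div]
      exact one_div_le_one_div_of_le (Real.exp_pos 1)
        (Real.exp_one_lt_d9.le.trans (by norm_num))
    have h5 : Real.exp (-1) ≤ Real.exp (-c * Real.sqrt L) := Real.exp_le_exp.2 (by linarith)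
    calc (1 : ℝ) = 4 * 1 * (1 / 4) := by norm_num
      _ ≤ _ := by gcongr; exact h4.trans h5
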